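/- Let $k\ge 1$ be an integer and let $\beta_k$ denote the unique solution $\beta\in[0,k-1]$ of $$\beta\,(1-\log\beta+\log k)=k-1$$ (with the convention $0\log 0=0$, so that $\beta_1=0$). Let $\Omega(n)$ be the number of prime factors of $n$ counted with multiplicity. For an integer $T\ge 2$ let $(x_1,\dots,x_k)$ be uniformly distributed over the integer vectors in $[1,T]^k$, and write $\mathbb P$ for the corresponding probability. Then for every $\varepsilon>0$ there are $\delta>0$, $c>0$, $C>0$ and $T_0$, depending only on $k$ and $\varepsilon$, such that for all integers $T\ge 2$ with $T>T_0$, $$\mathbb P\bigl[\Omega(x_1x_2\cdots x_k)\le(\beta_k+\varepsilon)\log\log T\bigr]\ \ge\ \frac{c}{(\log T)^{1-\delta}},$$ and, if $k\ge 2$, $$\mathbb P\bigl[\Omega(x_1x_2\cdots x_k)\le(\beta_k-\varepsilon)\log\log T\bigr]\ \le\ \frac{C}{(\log T)^{1+\delta}}.$$ -/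

import Mathlib

/-- For `k ≥ 1` the function `t ↦ t (1 - log t + log k)` is strictly increasing on `[0, k]`. -/
theorem strictMonoOn_betaFun (k : ℕ) (hk : 1 ≤ k) :
    StrictMonoOn (fun t : ℝ => t * (1 - Real.log t + Real.log k)) (Set.Icc 0 (k : ℝ)) := by
  have e : (fun t : ℝ => t * (1 - Real.log t + Real.log k)) =
      fun t : ℝ => t - t * Real.log t + t * Real.log k := by
    funext t; ring
  rw [e]
  have hk0 : (0 : ℝ) < k := by exact_mod_cast hk
  refine strictMonoOn_of_deriv_pos (convex_Icc _ _) ?_ ?_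
  · exact ((continuous_id.sub Real.continuous_mul_log).add
      (continuous_id.mul continuous_const)).continuousOn
  · intro x hx
    rw [interior_Icc] at hx
    have h1 : HasDerivAt (fun t : ℝ => t - t * Real.log t + t * Real.log k)
        (1 - (Real.log x + 1) + 1 * Real.log k) x :=
      ((hasDerivAt_id x).sub (Real.hasDerivAt_mul_log hx.1.ne')).add
        ((hasDerivAt_id x).mul_const _)
    rw [h1.deriv]
    have := Real.log_lt_log hx.1 hx.2
    linarith

/-- For `k ≥ 1` the equation `β (1 - log β + log k) = k - 1` has exactly one solution `β` in
`[0, k - 1]` (with the usual convention `0 log 0 = 0`, relevant only for `k = 1`). -/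
theorem existsUnique_beta (k : ℕ) (hk : 1 ≤ k) :
    ∃! β : ℝ, β ∈ Set.Icc (0 : ℝ) (k - 1) ∧
      β * (1 - Real.log β + Real.log k) = k - 1 := by
  have hk1 : (1 : ℝ) ≤ k := by exact_mod_cast hk
  have hmono := strictMonoOn_betaFun k hk
  have hcont : ContinuousOn (fun t : ℝ => t * (1 - Real.log t + Real.log k))
      (Set.Icc 0 ((k : ℝ) - 1)) := by
    have e : (fun t : ℝ => t * (1 - Real.log t + Real.log k)) =
        fun t : ℝ => t - t * Real.log t + t * Real.log k := by
      funext t; ring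
    rw [e]
    exact ((continuous_id.sub Real.continuous_mul_log).add
      (continuous_id.mul continuous_const)).continuousOn
  have hmem : (k : ℝ) - 1 ∈ Set.Icc ((0 : ℝ) * (1 - Real.log 0 + Real.log k))
      (((k : ℝ) - 1) * (1 - Real.log ((k : ℝ) - 1) + Real.log k)) := by
    refine ⟨by simp [hk1], ?_⟩
    rcases hk1.eq_or_lt with h | h
    · simp [← h]
    · have h2 : Real.log ((k : ℝ) - 1) ≤ Real.log k :=
        Real.log_le_log (by linarith) (by linarith)
      nlinarith
  obtain ⟨β, hβ, hβ'⟩ := intermediate_value_Icc (by linarith : (0 : ℝ) ≤ k - 1) hcont hmem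
  refine ⟨β, ⟨hβ, hβ'⟩, ?_⟩
  rintro γ ⟨hγ, hγ'⟩
  refine hmono.injOn ⟨hγ.1, by linarith [hγ.2]⟩ ⟨hβ.1, by linarith [hβ.2]⟩ ?_
  exact hγ'.trans hβ'.symm

open Classical in
/-- For `k ≥ 1`, `beta k` is the unique solution `β` in `[0, k - 1]` of
`β (1 - log β + log k) = k - 1`. -/
noncomputable def beta (k : ℕ) : ℝ :=
  if hk : 1 ≤ k then (existsUnique_beta k hk).choose else 0

theorem beta_spec (k : ℕ) (hk : 1 ≤ k) :
    beta k ∈ Set.Icc (0 : ℝ) (k - 1) ∧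
      beta k * (1 - Real.log (beta k) + Real.log k) = k - 1 := by
  rw [beta, dif_pos hk]
  exact (existsUnique_beta k hk).choose_spec.1

theorem eq_beta (k : ℕ) (hk : 1 ≤ k) (β : ℝ) (hβ : β ∈ Set.Icc (0 : ℝ) (k - 1))
    (h : β * (1 - Real.log β + Real.log k) = k - 1) : β = beta k :=
  (existsUnique_beta k hk).unique ⟨hβ, h⟩ (beta_spec k hk)

/-- The law of a vector `(x₁, …, x_k)` drawn uniformly from the integer vectors in `[1, T]^k`. -/
noncomputable def uniformDraw (k T : ℕ) : MeasureTheory.Measure (Fin k → ℕ) :=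
  ProbabilityTheory.uniformOn {x : Fin k → ℕ | ∀ i, x i ∈ Set.Icc 1 T}

theorem isProbabilityMeasure_uniformDraw (k T : ℕ) (hT : 1 ≤ T) :
    MeasureTheory.IsProbabilityMeasure (uniformDraw k T) := by
  refine ProbabilityTheory.isProbabilityMeasure_uniformOn ?_ ⟨fun _ => 1, fun _ => ⟨le_rfl, hT⟩⟩
  have h := Set.Finite.pi' (fun _ : Fin k => Set.finite_Icc 1 T)
  exact h

/-!
The coordinates are independent, so both estimates reduce to one uniform integer `n ≤ T`. Write
`L = log log T`. The exponent of `log T` in `ℙ[Ω(n) ≤ a L]`, for `0 < a < 1`, is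
`a - a log a - 1`; raised to the `k`-th power, with `α = k a`, this becomes
`α (1 - log α + log k) - k`, which is increasing in `α ∈ [0, k]` and equals `-1` exactly at
`α = beta k`.

**Upper bound.** By Chernoff's inequality with the weight `z ^ Ω(n)`, `z = α / k`, it is enough that
`∑_{n ≤ T} z ^ Ω(n) = O(T (log T) ^ (z - 1))` (`exists_eventually_sum_pow_cardFactors_le`).
Inserting `log n = ∑_{d ∣ n} Λ(d)` and using Chebyshev's bound for `ψ` reduces this to
`∑_{n ≤ T} z ^ Ω(n) / n = O((log T) ^ z)`. Rankin's trick at `s = 1 + 1 / log T` bounds the latter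
sum by the Dirichlet series of `z ^ Ω(n)`, and Bernoulli's inequality `(1 - u) ^ z ≤ 1 - z u`,
applied to each Euler factor, bounds that series by `ζ(s) ^ z ≤ (2 log T) ^ z`.

**Lower bound.** Many integers with few prime factors are exhibited
(`eventually_mul_rpow_le_card_cardFactors_le`): products `n = m p`, where `m` is a product of
`j = ⌊a L⌋ - 1` primes up to `w = exp ((log T) ^ (1 - η))`, so that `m ≤ w ^ j ≤ T ^ (1/3)`, and `p`
is a prime in `(w ^ j, T / m]`. Chebyshev's lower bound gives `≫ T / (m log T)` choices of `p`, and
unique factorisation gives `∑ 1 / m ≥ (∑_{p ≤ w} 1 / p) ^ j / j!` (`pow_sum_inv_primes_le`). As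
`∑_{p ≤ w} 1 / p ≥ log log w - O(1) ≥ (1 - 2 η) L`, Stirling's estimate for `j!` yields the exponent
`a - a log a - 1` up to an error that vanishes with `η`.
-/

open Filter Topology Finset

/-! ### The mean value of `z ^ Ω(n)` -/

/-- The completely multiplicative function `n ↦ z ^ Ω(n) / n ^ s`, as a monoid-with-zero
homomorphism; its value at `0` is `0`, since `(0 : ℝ) ^ (-s) = 0` for `s ≠ 0`. -/
noncomputable def powCardFactorsHom (z s : ℝ) (hs : s ≠ 0) : ℕ →*₀ ℝ where
  toFun n := z ^ ArithmeticFunction.cardFactors n * (n : ℝ) ^ (-s)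
  map_zero' := by simp [Real.zero_rpow (neg_ne_zero.2 hs)]
  map_one' := by simp
  map_mul' m n := by
    rcases eq_or_ne m 0 with rfl | hm
    · simp [Real.zero_rpow (neg_ne_zero.2 hs)]
    rcases eq_or_ne n 0 with rfl | hn
    · simp [Real.zero_rpow (neg_ne_zero.2 hs)]
    rw [ArithmeticFunction.cardFactors_mul hm hn, Nat.cast_mul,
      Real.mul_rpow (by positivity) (by positivity), pow_add]
    ring

theorem powCardFactorsHom_apply (z s : ℝ) (hs : s ≠ 0) (n : ℕ) :
    powCardFactorsHom z s hs n = z ^ ArithmeticFunction.cardFactors n * (n : ℝ) ^ (-s) := rfl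

theorem summable_norm_powCardFactorsHom {z s : ℝ} (hz0 : 0 ≤ z) (hz1 : z ≤ 1) (hs : 1 < s) :
    Summable (fun n => ‖powCardFactorsHom z s (by linarith) n‖) := by
  refine Summable.of_nonneg_of_le (fun _ => norm_nonneg _) (fun n => ?_)
    (Real.summable_nat_rpow.2 (by linarith : -s < -1))
  rw [powCardFactorsHom_apply, norm_mul, Real.norm_of_nonneg (by positivity),
    Real.norm_of_nonneg (by positivity)]
  exact mul_le_of_le_one_left (by positivity) (pow_le_one₀ hz0 hz1)

/-- Each Euler factor on the left is at most the `z`-th power of the one on the right, by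
Bernoulli's inequality `(1 - u) ^ z ≤ 1 - z u`. -/
theorem tsum_powCardFactorsHom_le {z s : ℝ} (hz0 : 0 ≤ z) (hz1 : z ≤ 1) (hs : 1 < s) :
    ∑' n, powCardFactorsHom z s (by linarith) n ≤ (∑' n : ℕ, 1 / (n : ℝ) ^ s) ^ z := by
  have h1 := EulerProduct.eulerProduct_completely_multiplicative_hasProd
    (summable_norm_powCardFactorsHom hz0 hz1 hs)
  have h2 := EulerProduct.eulerProduct_completely_multiplicative_hasProd
    (summable_norm_powCardFactorsHom zero_le_one le_rfl hs)
  have e : ∑' n, powCardFactorsHom 1 s (by linarith) n = ∑' n : ℕ, 1 / (n : ℝ) ^ s := by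
    refine tsum_congr fun n => ?_
    rw [powCardFactorsHom_apply, one_pow, one_mul, Real.rpow_neg (by positivity), one_div]
  rw [← e]
  refine le_of_tendsto_of_tendsto' h1 (h2.rpow_const (Or.inr hz0)) fun S => ?_
  have hu : ∀ p : Nat.Primes, 0 < (p : ℝ) ^ (-s) ∧ (p : ℝ) ^ (-s) < 1 := fun p =>
    ⟨Real.rpow_pos_of_pos (by exact_mod_cast p.2.pos) _,
      Real.rpow_lt_one_of_one_lt_of_neg (by exact_mod_cast p.2.one_lt) (by linarith)⟩
  have hf : ∀ (y : ℝ) (p : Nat.Primes),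
      powCardFactorsHom y s (by linarith) p = y * (p : ℝ) ^ (-s) := fun y p => by
    rw [powCardFactorsHom_apply, ArithmeticFunction.cardFactors_apply_prime p.2, pow_one]
  simp only [hf, one_mul]
  rw [← Real.finsetProd_rpow _ _ fun p _ => inv_nonneg.2 (by linarith [(hu p).2])]
  refine prod_le_prod (fun p _ => inv_nonneg.2 ?_) fun p _ => ?_
  · nlinarith [hu p]
  · have hp := hu p
    rw [Real.inv_rpow (by linarith)]
    refine inv_anti₀ (Real.rpow_pos_of_pos (by linarith) _) ?_
    have := rpow_one_add_le_one_add_mul_self (s := -(p : ℝ) ^ (-s)) (by linarith) hz0 hz1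
    rw [← sub_eq_add_neg] at this
    linarith

/-- Rankin's trick at `s = 1 + 1 / log T`, where `n ^ (1 / log T) ≤ e` for `n ≤ T`. -/
theorem eventually_sum_pow_cardFactors_div_le {z : ℝ} (hz0 : 0 ≤ z) (hz1 : z ≤ 1) :
    ∀ᶠ T : ℕ in atTop,
      ∑ n ∈ Icc 1 T, z ^ ArithmeticFunction.cardFactors n / (n : ℝ) ≤
        Real.exp 1 * 2 ^ z * Real.log T ^ z := by
  have hlog : Tendsto (fun T : ℕ => Real.log T) atTop atTop :=
    Real.tendsto_log_atTop.comp tendsto_natCast_atTop_atTop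
  have hs : Tendsto (fun T : ℕ => 1 + (Real.log T)⁻¹) atTop (𝓝[>] 1) := by
    refine tendsto_nhdsWithin_iff.2 ⟨?_, ?_⟩
    · simpa using (tendsto_inv_atTop_zero.comp hlog).const_add 1
    · filter_upwards [hlog.eventually_gt_atTop 0] with T hT
      simpa using hT
  have hz := (tendsto_sub_mul_tsum_nat_rpow.comp hs).eventually_le_const
    (show (1 : ℝ) < 2 by norm_num)
  filter_upwards [hz, hlog.eventually_gt_atTop 0] with T hT hL
  simp only [Function.comp_apply, add_sub_cancel_left] at hT
  have hs1 : 1 < 1 + (Real.log T)⁻¹ := by simpa using hL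
  have hzeta : ∑' n : ℕ, 1 / (n : ℝ) ^ (1 + (Real.log T)⁻¹) ≤ 2 * Real.log T := by
    rw [inv_mul_le_iff₀ hL] at hT
    linarith
  calc ∑ n ∈ Icc 1 T, z ^ ArithmeticFunction.cardFactors n / (n : ℝ)
      ≤ ∑ n ∈ Icc 1 T, Real.exp 1 * powCardFactorsHom z (1 + (Real.log T)⁻¹) (by linarith) n := by
        refine sum_le_sum fun n hn => ?_
        rw [mem_Icc] at hn
        have hn0 : (0 : ℝ) < n := by exact_mod_cast hn.1
        have hlogn : Real.log n ≤ Real.log T := Real.log_le_log hn0 (by exact_mod_cast hn.2)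
        rw [powCardFactorsHom_apply, div_eq_mul_inv, mul_left_comm]
        refine mul_le_mul_of_nonneg_left ?_ (by positivity)
        rw [← Real.rpow_neg_one, Real.rpow_def_of_pos hn0, Real.rpow_def_of_pos hn0,
          ← Real.exp_add]
        refine Real.exp_le_exp.2 ?_
        have : Real.log n * (Real.log T)⁻¹ ≤ 1 := by
          rw [← div_eq_mul_inv]; exact div_le_one_of_le₀ hlogn hL.le
        linarith
    _ ≤ Real.exp 1 * ∑' n, powCardFactorsHom z (1 + (Real.log T)⁻¹) (by linarith) n := by
        rw [← mul_sum]
        refine mul_le_mul_of_nonneg_left ?_ (Real.exp_pos 1).le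
        refine Summable.sum_le_tsum _ (fun n _ => ?_)
          (summable_norm_powCardFactorsHom hz0 hz1 hs1).of_norm
        rw [powCardFactorsHom_apply]; positivity
    _ ≤ Real.exp 1 * (2 * Real.log T) ^ z := by
        refine mul_le_mul_of_nonneg_left ?_ (Real.exp_pos 1).le
        refine (tsum_powCardFactorsHom_le hz0 hz1 hs1).trans ?_
        exact Real.rpow_le_rpow (tsum_nonneg fun n => by positivity) hzeta hz0
    _ = _ := by rw [Real.mul_rpow (by norm_num) hL.le]; ring

/-- The weight `log n = ∑_{d ∣ n} Λ(d)` is distributed over the factorisations `n = d m`, and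
`∑_{d ≤ T / m} Λ(d)` is bounded by Chebyshev's estimate. -/
theorem sum_pow_cardFactors_mul_log_le {z : ℝ} (hz0 : 0 ≤ z) (hz1 : z ≤ 1) (T : ℕ) :
    ∑ n ∈ Icc 1 T, z ^ ArithmeticFunction.cardFactors n * Real.log n ≤
      (Real.log 4 + 4) * T * ∑ m ∈ Icc 1 T, z ^ ArithmeticFunction.cardFactors m / (m : ℝ) := by
  calc ∑ n ∈ Icc 1 T, z ^ ArithmeticFunction.cardFactors n * Real.log n
      = ∑ n ∈ Ioc 0 T, ∑ x ∈ n.divisorsAntidiagonal,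
          z ^ ArithmeticFunction.cardFactors (x.1 * x.2) * ArithmeticFunction.vonMangoldt x.2 := by
        refine sum_congr rfl fun n _ => ?_
        rw [← ArithmeticFunction.vonMangoldt_sum, ← Nat.sum_divisorsAntidiagonal'
          (fun _ i => ArithmeticFunction.vonMangoldt i), mul_sum]
        refine sum_congr rfl fun x hx => ?_
        rw [(Nat.mem_divisorsAntidiagonal.1 hx).1]
    _ ≤ ∑ n ∈ Ioc 0 T, ∑ x ∈ n.divisorsAntidiagonal,
          z ^ ArithmeticFunction.cardFactors x.1 * ArithmeticFunction.vonMangoldt x.2 := by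
        refine sum_le_sum fun n _ => sum_le_sum fun x hx => ?_
        refine mul_le_mul_of_nonneg_right ?_ ArithmeticFunction.vonMangoldt_nonneg
        have h := Nat.mem_divisorsAntidiagonal.1 hx
        have h0 := mul_ne_zero_iff.1 (h.1.symm ▸ h.2)
        rw [ArithmeticFunction.cardFactors_mul h0.1 h0.2]
        exact pow_le_pow_of_le_one hz0 hz1 (Nat.le_add_right _ _)
    _ = ∑ m ∈ Ioc 0 T, ∑ d ∈ Ioc 0 (T / m),
          z ^ ArithmeticFunction.cardFactors m * ArithmeticFunction.vonMangoldt d := by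
        let f : ArithmeticFunction ℝ :=
          ⟨fun n => if n = 0 then 0 else z ^ ArithmeticFunction.cardFactors n, if_pos rfl⟩
        have hf : ∀ n, n ≠ 0 → f n = z ^ ArithmeticFunction.cardFactors n := fun n hn => if_neg hn
        have h := ArithmeticFunction.sum_Ioc_mul_eq_sum_sum f ArithmeticFunction.vonMangoldt T
        simp only [ArithmeticFunction.mul_apply] at h
        convert h using 1
        · refine sum_congr rfl fun n _ => sum_congr rfl fun x hx => ?_
          have h := Nat.mem_divisorsAntidiagonal.1 hx
          rw [hf _ (mul_ne_zero_iff.1 (h.1.symm ▸ h.2)).1]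
        · refine sum_congr rfl fun m hm => ?_
          rw [hf m (mem_Ioc.1 hm).1.ne', mul_sum]
    _ ≤ ∑ m ∈ Ioc 0 T, (Real.log 4 + 4) * T *
          (z ^ ArithmeticFunction.cardFactors m / (m : ℝ)) := by
        refine sum_le_sum fun m _ => ?_
        have h := Chebyshev.psi_le_const_mul_self (x := (T : ℝ) / m) (by positivity)
        rw [Chebyshev.psi, Nat.floor_div_natCast, Nat.floor_natCast] at h
        rw [← mul_sum]
        calc _ ≤ z ^ ArithmeticFunction.cardFactors m * ((Real.log 4 + 4) * ((T : ℝ) / m)) :=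
              mul_le_mul_of_nonneg_left h (by positivity)
          _ = _ := by ring
    _ = _ := by rw [mul_sum]; rfl

/-- The partial sums of `z ^ Ω(n)` are `O(T (log T) ^ (z - 1))` for `0 ≤ z ≤ 1`. -/
theorem exists_eventually_sum_pow_cardFactors_le {z : ℝ} (hz0 : 0 ≤ z) (hz1 : z ≤ 1) :
    ∃ C : ℝ, 0 < C ∧ ∀ᶠ T : ℕ in atTop,
      ∑ n ∈ Icc 1 T, z ^ ArithmeticFunction.cardFactors n ≤
        C * T * Real.log T ^ (z - 1) := by
  have h4 : 0 < Real.log 4 := Real.log_pos (by norm_num)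
  refine ⟨(Real.log 4 + 5) * (Real.exp 1 * 2 ^ z), by positivity, ?_⟩
  filter_upwards [eventually_sum_pow_cardFactors_div_le hz0 hz1, eventually_ge_atTop 2]
    with T hT hT2
  have hL : 0 < Real.log T := Real.log_pos (by exact_mod_cast hT2)
  have hT0 : (0 : ℝ) < T := by positivity
  -- `log T = log n + log (T / n)`, and `log (T / n) ≤ T / n`
  have hsplit : (∑ n ∈ Icc 1 T, z ^ ArithmeticFunction.cardFactors n) * Real.log T ≤
      ∑ n ∈ Icc 1 T, z ^ ArithmeticFunction.cardFactors n * Real.log n +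
        T * ∑ n ∈ Icc 1 T, z ^ ArithmeticFunction.cardFactors n / (n : ℝ) := by
    rw [sum_mul, mul_sum, ← sum_add_distrib]
    refine sum_le_sum fun n hn => ?_
    have hn0 : (0 : ℝ) < n := by exact_mod_cast (mem_Icc.1 hn).1
    have h := Real.log_le_self (div_nonneg hT0.le hn0.le)
    rw [Real.log_div hT0.ne' hn0.ne'] at h
    have hz : 0 ≤ z ^ ArithmeticFunction.cardFactors n := by positivity
    calc _ ≤ z ^ ArithmeticFunction.cardFactors n * (Real.log n + T / n) :=
          mul_le_mul_of_nonneg_left (by linarith) hz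
      _ = _ := by ring
  have h2 := sum_pow_cardFactors_mul_log_le hz0 hz1 T
  rw [Real.rpow_sub_one hL.ne', ← mul_div_assoc, le_div_iff₀ hL]
  refine hsplit.trans ?_
  calc _ ≤ (Real.log 4 + 4) * T * (Real.exp 1 * 2 ^ z * Real.log T ^ z) +
        T * (Real.exp 1 * 2 ^ z * Real.log T ^ z) := by
        gcongr
        exact h2.trans (mul_le_mul_of_nonneg_left hT (by positivity))
    _ = _ := by ring

/-! ### Products of small primes and one large prime -/

/-- Comparison of `∏_{p ≤ N} (1 - 1 / p)⁻¹` with the harmonic sum up to `N`. -/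
theorem exists_log_log_le_sum_inv_primesBelow :
    ∃ C : ℝ, ∀ N : ℕ, 1 ≤ N →
      Real.log (Real.log (N + 1)) ≤ ∑ p ∈ (N + 1).primesBelow, (p : ℝ)⁻¹ + C := by
  have hsum : Summable (fun n : ℕ => 2 * ((n : ℝ) ^ 2)⁻¹) :=
    (Real.summable_nat_pow_inv.2 one_lt_two).mul_left 2
  refine ⟨∑' n : ℕ, 2 * ((n : ℝ) ^ 2)⁻¹, fun N hN => ?_⟩
  let f : ℕ →* ℝ :=
    { toFun := fun n => (n : ℝ)⁻¹
      map_one' := by simp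
      map_mul' := fun m n => by rw [Nat.cast_mul, mul_inv] }
  have hp : ∀ {p : ℕ}, p.Prime → ‖f p‖ < 1 := fun {p} hp => by
    refine (Real.norm_of_nonneg (by positivity : (0 : ℝ) ≤ (p : ℝ)⁻¹)).trans_lt ?_
    exact inv_lt_one_of_one_lt₀ (by exact_mod_cast hp.one_lt)
  have hprod : HasSum (fun m : (N + 1).smoothNumbers => ((m : ℕ) : ℝ)⁻¹)
      (∏ p ∈ (N + 1).primesBelow, (1 - (p : ℝ)⁻¹)⁻¹) :=
    (EulerProduct.summable_and_hasSum_smoothNumbers_prod_primesBelow_geometric hp (N + 1)).2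
  have hharm : Real.log (N + 1) ≤ ∏ p ∈ (N + 1).primesBelow, (1 - (p : ℝ)⁻¹)⁻¹ := by
    have h1 := log_add_one_le_harmonic N
    rw [harmonic_eq_sum_Icc] at h1
    push_cast at h1
    refine h1.trans ?_
    have hmem : ∀ n ∈ Icc 1 N, n ∈ (N + 1).smoothNumbers := fun n hn =>
      Nat.mem_smoothNumbers_of_lt (mem_Icc.1 hn).1 (Nat.lt_succ_of_le (mem_Icc.1 hn).2)
    rw [← sum_coe_sort]
    have hinj : Function.Injective
        (fun n : Icc 1 N => (⟨n, hmem n n.2⟩ : (N + 1).smoothNumbers)) := fun x y h => by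
      exact Subtype.ext (congrArg (fun a : (N + 1).smoothNumbers => (a : ℕ)) h)
    have h2 := hprod.summable.sum_le_tsum (univ.map ⟨_, hinj⟩)
      (fun n _ => (by positivity : (0 : ℝ) ≤ ((n : ℕ) : ℝ)⁻¹))
    rw [sum_map, hprod.tsum_eq] at h2
    exact h2
  have hN1 : (1 : ℝ) < N + 1 := by
    have : (1 : ℝ) ≤ N := by exact_mod_cast hN
    linarith
  have hpr : ∀ p ∈ (N + 1).primesBelow, (2 : ℝ) ≤ p := fun p hp => by
    exact_mod_cast (Nat.prime_of_mem_primesBelow hp).two_le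
  calc Real.log (Real.log (N + 1))
      ≤ Real.log (∏ p ∈ (N + 1).primesBelow, (1 - (p : ℝ)⁻¹)⁻¹) :=
        Real.log_le_log (Real.log_pos hN1) hharm
    _ = ∑ p ∈ (N + 1).primesBelow, Real.log (1 - (p : ℝ)⁻¹)⁻¹ := by
        refine Real.log_prod fun p hp => inv_ne_zero ?_
        have := inv_lt_one_of_one_lt₀ (by linarith [hpr p hp] : (1 : ℝ) < p)
        linarith
    _ ≤ ∑ p ∈ (N + 1).primesBelow, ((p : ℝ)⁻¹ + 2 * ((p : ℝ) ^ 2)⁻¹) := by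
        refine sum_le_sum fun p hp => ?_
        have h2 := hpr p hp
        have h1 : (0 : ℝ) < 1 - (p : ℝ)⁻¹ := by
          have := inv_lt_one_of_one_lt₀ (by linarith : (1 : ℝ) < p)
          linarith
        refine (Real.log_le_sub_one_of_pos (inv_pos.2 h1)).trans ?_
        -- `(1 - 1 / p)⁻¹ - 1 = 1 / (p - 1)`
        have e : (1 - (p : ℝ)⁻¹)⁻¹ - 1 = 1 / (p - 1) := by
          have : (p : ℝ) - 1 ≠ 0 := by linarith
          field_simp
          ring
        rw [e, div_le_iff₀ (by linarith)]
        field_simp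
        nlinarith
    _ ≤ _ := by
        rw [sum_add_distrib]
        gcongr
        exact hsum.sum_le_tsum _ fun n _ => by positivity

/-- A multiset of size `j` has at most `j!` orderings. -/
theorem Multiset.countPerms_le_factorial {α : Type*} [DecidableEq α] (m : Multiset α) :
    m.countPerms ≤ m.card.factorial := by
  rw [Multiset.countPerms, Finsupp.multinomial_eq]
  have h := Nat.multinomial_spec m.toFinsupp.support m.toFinsupp
  have hc : ∑ i ∈ m.toFinsupp.support, m.toFinsupp i = m.card := by
    exact Multiset.toFinsupp_sum_eq m
  rw [hc] at h
  rw [← h]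
  exact Nat.le_mul_of_pos_left _ (Finset.prod_pos fun i _ => Nat.factorial_pos _)

/-- The `j`-th power of `∑_{p ∈ P} 1 / p` is expanded over multisets of primes; by unique
factorisation these correspond to their products. -/
theorem pow_sum_inv_primes_le (P : Finset ℕ) (hP : ∀ p ∈ P, p.Prime) (j : ℕ) :
    (∑ p ∈ P, (p : ℝ)⁻¹) ^ j ≤
      j.factorial *
        ∑ m ∈ (P.sym j).image (fun s : Sym ℕ j => (s : Multiset ℕ).prod), (m : ℝ)⁻¹ := by
  have hprime : ∀ s : Sym ℕ j, s ∈ P.sym j → ∀ p ∈ (s : Multiset ℕ), Prime p := fun s hs p hp =>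
    (hP p (mem_sym_iff.1 hs p hp)).prime
  rw [sum_pow, sum_image, mul_sum]
  · refine sum_le_sum fun s _ => ?_
    have e : ((s : Multiset ℕ).map fun p : ℕ => (p : ℝ)⁻¹).prod =
        (((s : Multiset ℕ).prod : ℕ) : ℝ)⁻¹ := by
      rw [Multiset.prod_map_inv, Nat.cast_multiset_prod]
    have hc := (s : Multiset ℕ).countPerms_le_factorial
    rw [Sym.card_coe] at hc
    refine (congrArg (fun x : ℝ => ((s : Multiset ℕ).countPerms : ℝ) * x) e).trans_le ?_
    gcongr
  · intro s hs t ht hst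
    have h := UniqueFactorizationMonoid.normalizedFactors_prod_of_prime (hprime s hs)
    rw [show (s : Multiset ℕ).prod = (t : Multiset ℕ).prod from hst,
      UniqueFactorizationMonoid.normalizedFactors_prod_of_prime (hprime t ht)] at h
    exact Sym.coe_injective h.symm

/-- Appending to each `m ∈ A` a prime `p > M ≥ m` gives distinct products `m p`, since `p` is the
largest prime factor of `m p`. -/
theorem sum_primeCounting_sub_le_card {A : Finset ℕ} {M j T : ℕ}
    (hA : ∀ m ∈ A, 0 < m ∧ m ≤ M ∧ ArithmeticFunction.cardFactors m = j) :
    ∑ m ∈ A, ((Nat.primeCounting (T / m) : ℝ) - M) ≤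
      #{n ∈ Icc 1 T | ArithmeticFunction.cardFactors n = j + 1} := by
  have h1 : #(A.sigma fun m => {p ∈ Ioc M (T / m) | p.Prime}) ≤
      #{n ∈ Icc 1 T | ArithmeticFunction.cardFactors n = j + 1} := by
    refine card_le_card_of_injOn (fun x => x.1 * x.2) ?_ ?_
    · rintro ⟨m, p⟩ hx
      simp only [coe_sigma, Set.mem_sigma_iff, mem_coe, mem_filter, mem_Ioc] at hx
      obtain ⟨hm, ⟨-, hpT⟩, hp⟩ := hx
      obtain ⟨hm0, -, hmj⟩ := hA m hm
      simp only [coe_filter, Set.mem_ofPred_eq, mem_Icc]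
      refine ⟨⟨Nat.mul_pos hm0 hp.pos, ?_⟩, ?_⟩
      · rw [mul_comm]; exact (Nat.le_div_iff_mul_le hm0).1 hpT
      · rw [ArithmeticFunction.cardFactors_mul hm0.ne' hp.ne_zero, hmj,
          ArithmeticFunction.cardFactors_apply_prime hp]
    · have key : ∀ m ∈ A, ∀ p q n : ℕ, p.Prime → M < p → q.Prime → m * q = n * p → p = q := by
        intro m hm p q n hp hMp hq h
        rcases (Nat.Prime.dvd_mul hp).1 (h ▸ Dvd.intro_left n rfl : p ∣ m * q) with h | h
        · have := Nat.le_of_dvd (hA m hm).1 h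
          have := (hA m hm).2.1
          omega
        · exact (Nat.prime_dvd_prime_iff_eq hp hq).1 h
      rintro ⟨m, q⟩ hx ⟨n, p⟩ hy h
      simp only [coe_sigma, Set.mem_sigma_iff, mem_coe, mem_filter, mem_Ioc] at hx hy
      have h : m * q = n * p := h
      obtain rfl := key m hx.1 p q n hy.2.2 hy.2.1.1 hx.2.2 h
      obtain rfl := Nat.eq_of_mul_eq_mul_right hy.2.2.pos h
      rfl
  have h2 : ∀ n : ℕ, (Nat.primeCounting n : ℝ) - M ≤ #{p ∈ Ioc M n | p.Prime} := by
    intro n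
    rw [sub_le_iff_le_add, Nat.primeCounting, Nat.primeCounting', Nat.count_eq_card_filter_range]
    have hsub : {p ∈ range (n + 1) | p.Prime} ⊆ {p ∈ Ioc M n | p.Prime} ∪ Ioc 0 M := by
      intro p hp
      simp only [mem_filter, mem_range, mem_union, mem_Ioc] at hp ⊢
      have := hp.2.pos
      rcases lt_or_ge M p with h | h
      · exact Or.inl ⟨⟨h, by omega⟩, hp.2⟩
      · exact Or.inr ⟨this, h⟩
    have := (card_le_card hsub).trans (card_union_le _ _)
    rw [Nat.card_Ioc, Nat.sub_zero] at this
    exact_mod_cast this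
  rw [card_sigma] at h1
  refine (sum_le_sum fun m _ => h2 (T / m)).trans ?_
  exact_mod_cast h1

theorem eventually_half_div_log_le_primeCounting :
    ∀ᶠ n : ℕ in atTop, (n : ℝ) / (2 * Real.log n) ≤ Nat.primeCounting n := by
  have h0 : ∀ᶠ n : ℕ in atTop, Real.log (n + 1 : ℕ) ≤ (1 / 20 : ℝ) * (n + 1 : ℕ) := by
    have h := (Real.isLittleO_log_id_atTop.bound (show (0 : ℝ) < 1 / 20 by norm_num))
    have h' := (tendsto_natCast_atTop_atTop (R := ℝ)).comp (tendsto_add_atTop_nat 1)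
    filter_upwards [h'.eventually h] with n hn
    simp only [Function.comp_apply, id, Real.norm_eq_abs, Nat.abs_cast] at hn
    exact (le_abs_self _).trans hn
  filter_upwards [h0, eventually_ge_atTop 2] with n hn hn2
  refine le_trans ?_ (Chebyshev.pi_ge n)
  have hn2' : (2 : ℝ) ≤ n := by exact_mod_cast hn2
  have hL : 0 < Real.log n := Real.log_pos (by linarith)
  rw [← div_div]
  refine div_le_div_of_nonneg_right ?_ hL.le
  push_cast at hn
  have := Real.log_two_gt_d9
  nlinarith

/-- The integers `n = m p` with `m ∈ A` and `p` a large prime. -/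
theorem eventually_mul_sum_inv_le_card :
    ∀ᶠ T : ℕ in atTop, ∀ (A : Finset ℕ) (M j : ℕ), M ^ 3 ≤ T →
      (∀ m ∈ A, 0 < m ∧ m ≤ M ∧ ArithmeticFunction.cardFactors m = j) →
      (T : ℝ) / (8 * Real.log T) * ∑ m ∈ A, (m : ℝ)⁻¹ ≤
        #{n ∈ Icc 1 T | ArithmeticFunction.cardFactors n = j + 1} := by
  obtain ⟨N, hN⟩ := eventually_atTop.1 eventually_half_div_log_le_primeCounting
  have hlog : ∀ᶠ T : ℕ in atTop, 8 * Real.log T ≤ (T : ℝ) ^ (1 / 3 : ℝ) := by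
    have h := (isLittleO_log_rpow_atTop (show (0 : ℝ) < 1 / 3 by norm_num)).bound
      (show (0 : ℝ) < 1 / 8 by norm_num)
    filter_upwards [tendsto_natCast_atTop_atTop.eventually h] with T hT
    rw [Real.norm_of_nonneg (by positivity : (0 : ℝ) ≤ (T : ℝ) ^ (1 / 3 : ℝ))] at hT
    have := (le_abs_self _).trans hT
    linarith
  have hbig : ∀ᶠ T : ℕ in atTop, ((N + 3 : ℕ) : ℝ) ≤ (T : ℝ) ^ (2 / 3 : ℝ) :=
    ((tendsto_rpow_atTop (by norm_num)).comp tendsto_natCast_atTop_atTop).eventually_ge_atTop _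
  filter_upwards [hlog, hbig, eventually_ge_atTop 2] with T hT8 hTN hT2 A M j hM hA
  have hT0 : (0 : ℝ) < T := by exact_mod_cast (by omega : 0 < T)
  have hL : 0 < Real.log T := Real.log_pos (by exact_mod_cast hT2)
  refine le_trans ?_ (sum_primeCounting_sub_le_card hA)
  rw [mul_sum]
  refine sum_le_sum fun m hm => ?_
  obtain ⟨hm0, hmM, -⟩ := hA m hm
  have hm0' : (0 : ℝ) < m := by exact_mod_cast hm0
  have hMT : (M : ℝ) ≤ (T : ℝ) ^ (1 / 3 : ℝ) := by
    rw [one_div, Real.le_rpow_inv_iff_of_pos (by positivity) hT0.le (by norm_num)]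
    exact_mod_cast hM
  have hmT : (m : ℝ) ≤ (T : ℝ) ^ (1 / 3 : ℝ) := le_trans (by exact_mod_cast hmM) hMT
  set y : ℝ := T / m with hy
  have hyT : (T : ℝ) ^ (2 / 3 : ℝ) ≤ y := by
    rw [hy, le_div_iff₀ hm0']
    calc _ ≤ (T : ℝ) ^ (2 / 3 : ℝ) * (T : ℝ) ^ (1 / 3 : ℝ) := by gcongr
      _ = T := by rw [← Real.rpow_add hT0]; norm_num
  have hyn : y < (T / m : ℕ) + 1 := by
    have := Nat.lt_floor_add_one y
    rwa [hy, Nat.floor_div_natCast, Nat.floor_natCast] at this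
  have hnN : N + 2 ≤ T / m := by
    have : ((N + 3 : ℕ) : ℝ) < ((T / m + 1 : ℕ) : ℝ) := by push_cast at *; linarith
    have := Nat.cast_lt.1 this
    omega
  have hpi := hN (T / m) (by omega)
  have hn1 : (1 : ℝ) < (T / m : ℕ) := by exact_mod_cast (by omega : 1 < T / m)
  have hpi2 : y / (4 * Real.log T) ≤ Nat.primeCounting (T / m) := by
    refine le_trans ?_ hpi
    have hln : 0 < Real.log (T / m : ℕ) := Real.log_pos hn1
    have hle : Real.log (T / m : ℕ) ≤ Real.log T :=
      Real.log_le_log (by linarith) (by exact_mod_cast Nat.div_le_self T m)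
    rw [div_le_div_iff₀ (by positivity) (by positivity)]
    calc y * (2 * Real.log (T / m : ℕ)) ≤ (2 * (T / m : ℕ)) * (2 * Real.log T) := by
          gcongr
          linarith
      _ = _ := by ring
  have hMy : (M : ℝ) ≤ y / (8 * Real.log T) := by
    rw [le_div_iff₀ (by positivity)]
    calc _ ≤ (T : ℝ) ^ (1 / 3 : ℝ) * (T : ℝ) ^ (1 / 3 : ℝ) := by gcongr
      _ = (T : ℝ) ^ (2 / 3 : ℝ) := by rw [← Real.rpow_add hT0]; norm_num
      _ ≤ y := hyT
  calc (T : ℝ) / (8 * Real.log T) * (m : ℝ)⁻¹ = y / (4 * Real.log T) - y / (8 * Real.log T) := by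
        rw [hy]; field_simp; norm_num
    _ ≤ _ := by linarith

theorem eventually_mul_pow_sum_inv_le_card :
    ∀ᶠ T : ℕ in atTop, ∀ w j : ℕ, (w ^ j) ^ 3 ≤ T →
      (T : ℝ) / (8 * Real.log T) *
          ((∑ p ∈ (w + 1).primesBelow, (p : ℝ)⁻¹) ^ j / j.factorial) ≤
        #{n ∈ Icc 1 T | ArithmeticFunction.cardFactors n = j + 1} := by
  filter_upwards [eventually_mul_sum_inv_le_card] with T hT w j hw
  have hP : ∀ p ∈ (w + 1).primesBelow, p.Prime := fun p hp => Nat.prime_of_mem_primesBelow hp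
  refine le_trans ?_
    (hT (((w + 1).primesBelow.sym j).image fun s : Sym ℕ j => (s : Multiset ℕ).prod)
      (w ^ j) j hw ?_)
  · refine mul_le_mul_of_nonneg_left ?_
      (div_nonneg (Nat.cast_nonneg _) (mul_nonneg (by norm_num) (Real.log_natCast_nonneg T)))
    rw [div_le_iff₀ (by positivity), mul_comm]
    exact pow_sum_inv_primes_le _ hP j
  · intro m hm
    obtain ⟨s, hs, rfl⟩ := mem_image.1 hm
    have hs' := mem_sym_iff.1 hs
    have h0 : (s : Multiset ℕ).prod ≠ 0 := Multiset.prod_ne_zero fun h =>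
      (hP 0 (hs' 0 h)).ne_zero rfl
    refine ⟨Nat.pos_of_ne_zero h0, ?_, ?_⟩
    · have := Multiset.prod_le_pow_card (s : Multiset ℕ) w fun p hp =>
        Nat.lt_succ_iff.1 (Nat.lt_of_mem_primesBelow (hs' p hp))
      rwa [Sym.card_coe] at this
    · have h1 : (s : Multiset ℕ).map ArithmeticFunction.cardFactors =
          (s : Multiset ℕ).map fun _ => 1 := Multiset.map_congr rfl fun p hp =>
        ArithmeticFunction.cardFactors_apply_prime (hP p (hs' p hp))
      rw [ArithmeticFunction.cardFactors_multiset_prod h0, h1]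
      simp

/-! ### Integers with few prime factors -/

theorem log_factorial_le {j : ℕ} (hj : 1 ≤ j) :
    Real.log j.factorial ≤ j * Real.log j - j + Real.log j + 1 := by
  induction j, hj using Nat.le_induction with
  | base => simp
  | succ j hj ih =>
    have hj0 : (0 : ℝ) < j := by exact_mod_cast hj
    rw [Nat.factorial_succ, Nat.cast_mul, Real.log_mul (by positivity) (by positivity)]
    push_cast
    -- the step amounts to `log (1 + 1 / j) ≥ 1 / (j + 1)`
    have h := Real.one_sub_inv_le_log_of_pos (show (0 : ℝ) < (j + 1) / j by positivity)
    rw [Real.log_div (by positivity) (by positivity), inv_div] at h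
    have e : (1 : ℝ) - j / (j + 1) = 1 / (j + 1) := by field_simp; ring
    rw [e, div_le_iff₀ (by positivity)] at h
    linarith

/-- Of the integers up to `T`, a proportion at least `(log T) ^ (E - 1)` has
`Ω(n) ≤ a log log T`, for any `E < a (1 - log a)`. The bound is `u ^ j / j!` with
`j ≈ a log log T` and `u ≈ log log T`, evaluated by Stirling's estimate. -/
theorem eventually_mul_rpow_le_card_cardFactors_le {a E : ℝ} (ha0 : 0 < a) (ha1 : a < 1)
    (hE : E < a * (1 - Real.log a)) :
    ∀ᶠ T : ℕ in atTop, (T : ℝ) * Real.log T ^ (E - 1) ≤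
      #{n ∈ Icc 1 T | (ArithmeticFunction.cardFactors n : ℝ) ≤ a * Real.log (Real.log T)} := by
  -- a small loss `η` in `log log T`
  obtain ⟨η, hη0, hηa, hη⟩ : ∃ η : ℝ, 0 < η ∧ a < 1 - 2 * η ∧
      E < a * (1 + Real.log (1 - 2 * η) - Real.log a) := by
    have h2 : ContinuousAt (fun η : ℝ => a * (1 + Real.log (1 - 2 * η) - Real.log a)) 0 := by
      refine ContinuousAt.mul continuousAt_const (ContinuousAt.sub ?_ continuousAt_const)
      exact continuousAt_const.add (ContinuousAt.log (by fun_prop) (by norm_num))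
    have h1 : ContinuousAt (fun η : ℝ => 1 - 2 * η) 0 := by fun_prop
    have e1 := h1.eventually (lt_mem_nhds (show a < 1 - 2 * (0 : ℝ) by simpa using ha1))
    have e2 := h2.eventually (lt_mem_nhds
      (show E < a * (1 + Real.log (1 - 2 * (0 : ℝ)) - Real.log a) by simpa using hE))
    obtain ⟨η, ⟨h, h'⟩, h0⟩ := (((e1.and e2).filter_mono nhdsWithin_le_nhds).and
      (self_mem_nhdsWithin : Set.Ioi (0 : ℝ) ∈ 𝓝[>] (0 : ℝ))).exists
    exact ⟨η, h0, h, h'⟩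
  set κ : ℝ := 1 + Real.log (1 - 2 * η) - Real.log a with hκ
  have hκ1 : 1 ≤ κ := by
    have := Real.log_le_log ha0 hηa.le
    linarith
  obtain ⟨C, hC⟩ := exists_log_log_le_sum_inv_primesBelow
  have hlog : Tendsto (fun T : ℕ => Real.log T) atTop atTop :=
    Real.tendsto_log_atTop.comp tendsto_natCast_atTop_atTop
  have hll : Tendsto (fun T : ℕ => Real.log (Real.log T)) atTop atTop :=
    Real.tendsto_log_atTop.comp hlog
  have hexp : ∀ᶠ x : ℝ in atTop, 3 * x ≤ Real.exp (η * x) := by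
    have h := (isLittleO_pow_exp_pos_mul_atTop 1 hη0).bound (show (0 : ℝ) < 1 / 3 by norm_num)
    filter_upwards [h] with x hx
    rw [pow_one, Real.norm_eq_abs, Real.norm_eq_abs, Real.abs_exp] at hx
    linarith [le_abs_self x]
  have hmain : ∀ᶠ x : ℝ in atTop, E * x + Real.log 8 ≤ (a * x - 2) * κ - Real.log x - 1 := by
    have h := Real.isLittleO_log_id_atTop.bound
      (show (0 : ℝ) < (a * κ - E) / 2 by linarith)
    filter_upwards [h, eventually_ge_atTop (0 : ℝ),
      (tendsto_id.const_mul_atTop (show (0 : ℝ) < (a * κ - E) / 2 by linarith)).eventually_ge_atTop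
        (Real.log 8 + 2 * κ + 1)] with x hx hx0 hx2
    simp only [id, Real.norm_eq_abs, abs_of_nonneg hx0] at hx hx2
    have := (le_abs_self _).trans hx
    linarith
  filter_upwards [eventually_mul_pow_sum_inv_le_card, hlog.eventually_gt_atTop 1,
    hll.eventually hexp, hll.eventually hmain,
    (hll.const_mul_atTop ha0).eventually_ge_atTop 2,
    (hll.const_mul_atTop hη0).eventually_ge_atTop C] with T hT hL hx hm ha2 hηC
  set L := Real.log (Real.log T) with hLdef
  have hlogT : 0 < Real.log T := by linarith
  have hLpos : 0 < L := Real.log_pos hL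
  have hexpL : Real.exp L = Real.log T := Real.exp_log hlogT
  have hT0 : (0 : ℝ) < T := by
    rcases Nat.eq_zero_or_pos T with rfl | h
    · simp at hlogT
    · exact_mod_cast h
  set j := ⌊a * L⌋₊ - 1 with hj
  have hfl : 2 ≤ ⌊a * L⌋₊ := Nat.le_floor (by exact_mod_cast ha2)
  have hj1 : 1 ≤ j := by omega
  have hjfl : j + 1 = ⌊a * L⌋₊ := by omega
  have hjle : (j : ℝ) + 1 ≤ a * L := by
    have := Nat.floor_le (show 0 ≤ a * L by positivity)
    rw [← hjfl] at this
    exact_mod_cast this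
  have hjge : a * L - 2 ≤ j := by
    have := Nat.lt_floor_add_one (a * L)
    rw [← hjfl] at this
    push_cast at this
    linarith
  have hj0 : (0 : ℝ) < j := by exact_mod_cast hj1
  have hjL : (j : ℝ) ≤ L := by nlinarith
  set v := Real.exp ((1 - η) * L) with hv
  set w := ⌊Real.exp v⌋₊ with hw
  have hw1 : 1 ≤ w := Nat.le_floor (by
    rw [Nat.cast_one]; exact Real.one_le_exp (Real.exp_pos _).le)
  have hwT : (w ^ j) ^ 3 ≤ T := by
    have h1 : ((w : ℝ) ^ j) ^ 3 ≤ T := by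
      calc ((w : ℝ) ^ j) ^ 3 ≤ (Real.exp v ^ j) ^ 3 := by
            gcongr
            exact Nat.floor_le (Real.exp_pos _).le
        _ = Real.exp (3 * j * v) := by
            rw [← Real.exp_nat_mul, ← Real.exp_nat_mul]; congr 1; push_cast; ring
        _ ≤ Real.exp (Real.exp (η * L) * v) := by
            gcongr
            linarith
        _ = T := by
            rw [hv, ← Real.exp_add, show η * L + (1 - η) * L = L by ring, hexpL,
              Real.exp_log hT0]
    exact_mod_cast h1
  have hS : (1 - 2 * η) * L ≤ ∑ p ∈ (w + 1).primesBelow, (p : ℝ)⁻¹ := by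
    have h1 := hC w hw1
    have h2 : (1 - η) * L ≤ Real.log (Real.log (w + 1)) := by
      rw [Real.le_log_iff_exp_le, Real.le_log_iff_exp_le (by positivity)]
      · exact (Nat.lt_floor_add_one _).le
      · exact Real.log_pos (by linarith [show (1 : ℝ) ≤ w by exact_mod_cast hw1])
    linarith
  have hu : 0 < (1 - 2 * η) * L := mul_pos (by linarith) hLpos
  -- Stirling's estimate for `u ^ j / j!`
  have hst : 8 * Real.exp (E * L) ≤ ((1 - 2 * η) * L) ^ j / j.factorial := by
    rw [← Real.exp_log (show 0 < ((1 - 2 * η) * L) ^ j / j.factorial by positivity),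
      ← Real.exp_log (show (0 : ℝ) < 8 by norm_num), ← Real.exp_add]
    refine Real.exp_le_exp.2 ?_
    rw [Real.log_div (by positivity) (by positivity), Real.log_pow,
      Real.log_mul (by linarith) hLpos.ne']
    have h1 := log_factorial_le hj1
    have h2 : Real.log j ≤ Real.log a + L.log := by
      rw [← Real.log_mul ha0.ne' hLpos.ne']
      exact Real.log_le_log hj0 (by linarith)
    have h3 : Real.log j ≤ Real.log L := Real.log_le_log hj0 hjL
    have h4 : (j : ℝ) * κ ≤ j * (1 + (Real.log (1 - 2 * η) + L.log) - Real.log j) :=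
      mul_le_mul_of_nonneg_left (by linarith) hj0.le
    have h5 : (a * L - 2) * κ ≤ j * κ := mul_le_mul_of_nonneg_right hjge (by linarith)
    linarith
  calc (T : ℝ) * Real.log T ^ (E - 1)
      = T / (8 * Real.log T) * (8 * Real.exp (E * L)) := by
        rw [Real.rpow_sub_one hlogT.ne', Real.rpow_def_of_pos hlogT, ← hLdef, mul_comm L]
        field_simp
    _ ≤ T / (8 * Real.log T) *
          ((∑ p ∈ (w + 1).primesBelow, (p : ℝ)⁻¹) ^ j / j.factorial) := by
        gcongr
        refine hst.trans ?_
        gcongr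
    _ ≤ #{n ∈ Icc 1 T | ArithmeticFunction.cardFactors n = j + 1} := hT w j hwT
    _ ≤ _ := by
        refine Nat.cast_le.2 (card_le_card fun n hn => ?_)
        rw [mem_filter] at hn ⊢
        refine ⟨hn.1, ?_⟩
        rw [hn.2]
        exact_mod_cast hjle

/-! ### Passage to the uniform measure -/

theorem uniformDraw_real_apply (k T : ℕ) (A : Set (Fin k → ℕ)) [DecidablePred (· ∈ A)] :
    (uniformDraw k T).real A =
      #{x ∈ Fintype.piFinset fun _ : Fin k => Icc 1 T | x ∈ A} / (T : ℝ) ^ k := by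
  have hs : {x : Fin k → ℕ | ∀ i, x i ∈ Set.Icc 1 T} =
      (Fintype.piFinset fun _ : Fin k => Icc 1 T : Finset (Fin k → ℕ)) := by
    ext x; simp only [Set.mem_ofPred_eq, Set.mem_Icc, mem_coe, Fintype.mem_piFinset, mem_Icc]
  have hfin : {x : Fin k → ℕ | ∀ i, x i ∈ Set.Icc 1 T}.Finite := by
    rw [hs]; exact finite_toSet _
  have hA : ((Fintype.piFinset fun _ : Fin k => Icc 1 T : Finset (Fin k → ℕ)) :
      Set (Fin k → ℕ)) ∩ A =
      ({x ∈ Fintype.piFinset fun _ : Fin k => Icc 1 T | x ∈ A} : Finset (Fin k → ℕ)) := by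
    ext x; simp only [Set.mem_inter_iff, mem_coe, mem_filter]
  rw [uniformDraw, MeasureTheory.measureReal_def, ← ProbabilityTheory.uniformOn_inter_self hfin,
    hs, hA, ProbabilityTheory.uniformOn_apply_finset, ENNReal.toReal_div, ENNReal.toReal_natCast,
    ENNReal.toReal_natCast, inter_eq_right.2 (filter_subset _ _), Fintype.card_piFinset]
  simp

theorem cardFactors_prod_eq_sum {k T : ℕ} {x : Fin k → ℕ}
    (hx : x ∈ Fintype.piFinset fun _ : Fin k => Icc 1 T) :
    ArithmeticFunction.cardFactors (∏ i, x i) =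
      ∑ i, ArithmeticFunction.cardFactors (x i) := by
  have h : ∀ i, x i ≠ 0 := fun i =>
    Nat.one_le_iff_ne_zero.1 (mem_Icc.1 (Fintype.mem_piFinset.1 hx i)).1
  have : ∀ s : Finset (Fin k), ArithmeticFunction.cardFactors (∏ i ∈ s, x i) =
      ∑ i ∈ s, ArithmeticFunction.cardFactors (x i) := by
    classical
    intro s
    induction s using Finset.induction_on with
    | empty => simp
    | insert i s hi ih =>
      rw [prod_insert hi, sum_insert hi,
        ArithmeticFunction.cardFactors_mul (h i) (prod_ne_zero_iff.2 fun i _ => h i), ih]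
  exact this univ

/-- If each coordinate has at most `a log log T` prime factors, the product has at most
`k a log log T` of them. -/
theorem eventually_rpow_le_uniformDraw {k : ℕ} {a E : ℝ} (ha0 : 0 < a) (ha1 : a < 1)
    (hE : E < a * (1 - Real.log a)) :
    ∀ᶠ T : ℕ in atTop, Real.log T ^ ((k : ℝ) * (E - 1)) ≤
      (uniformDraw k T).real {x : Fin k → ℕ |
        (ArithmeticFunction.cardFactors (∏ i, x i) : ℝ) ≤ k * a * Real.log (Real.log T)} := by
  filter_upwards [eventually_mul_rpow_le_card_cardFactors_le ha0 ha1 hE, eventually_gt_atTop 0]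
    with T hT hT0
  have hT0' : (0 : ℝ) < T := by exact_mod_cast hT0
  have hL : 0 ≤ Real.log T := Real.log_natCast_nonneg T
  classical
  rw [uniformDraw_real_apply, le_div_iff₀ (by positivity), mul_comm, mul_comm (k : ℝ),
    Real.rpow_mul hL, Real.rpow_natCast, ← mul_pow]
  refine (pow_le_pow_left₀ (by positivity) hT k).trans ?_
  rw [← Nat.cast_pow, Nat.cast_le, ← Fintype.card_fin k, ← Fintype.card_piFinset_const,
    Fintype.card_fin k]
  refine card_le_card fun x hx => ?_
  have hx' := fun i => mem_filter.1 (Fintype.mem_piFinset.1 hx i)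
  have hx1 : x ∈ Fintype.piFinset fun _ : Fin k => Icc 1 T :=
    Fintype.mem_piFinset.2 fun i => (hx' i).1
  refine mem_filter.2 ⟨hx1, ?_⟩
  rw [Set.mem_ofPred_eq, cardFactors_prod_eq_sum hx1, Nat.cast_sum]
  refine (sum_le_sum fun i _ => (hx' i).2).trans_eq ?_
  simp [mul_assoc]

/-- Chernoff's bound: `z ^ (Ω(x₁ ⋯ x_k) - k z log log T) ≥ 1` on the event. -/
theorem exists_eventually_uniformDraw_le {k : ℕ} {z : ℝ} (hz0 : 0 < z) (hz1 : z ≤ 1) :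
    ∃ C : ℝ, 0 < C ∧ ∀ᶠ T : ℕ in atTop,
      (uniformDraw k T).real {x : Fin k → ℕ |
        (ArithmeticFunction.cardFactors (∏ i, x i) : ℝ) ≤ k * z * Real.log (Real.log T)} ≤
      C * Real.log T ^ ((k : ℝ) * (z - z * Real.log z - 1)) := by
  obtain ⟨C, hC0, hC⟩ := exists_eventually_sum_pow_cardFactors_le hz0.le hz1
  refine ⟨C ^ k, by positivity, ?_⟩
  filter_upwards [hC, eventually_ge_atTop 2] with T hT hT2
  have hT0 : (0 : ℝ) < T := by positivity
  have hL : 0 < Real.log T := Real.log_pos (by exact_mod_cast hT2)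
  classical
  rw [uniformDraw_real_apply, div_le_iff₀ (by positivity)]
  set B := (k : ℝ) * z * Real.log (Real.log T) with hB
  set S := Fintype.piFinset fun _ : Fin k => Icc 1 T with hS
  calc (#{x ∈ S | x ∈ {x : Fin k → ℕ |
          (ArithmeticFunction.cardFactors (∏ i, x i) : ℝ) ≤ B}} : ℝ)
      = ∑ x ∈ S with x ∈ {x : Fin k → ℕ |
          (ArithmeticFunction.cardFactors (∏ i, x i) : ℝ) ≤ B}, (1 : ℝ) := by simp
    _ ≤ ∑ x ∈ S with x ∈ {x : Fin k → ℕ |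
          (ArithmeticFunction.cardFactors (∏ i, x i) : ℝ) ≤ B},
          z ^ (-B) * ∏ i, z ^ ArithmeticFunction.cardFactors (x i) := by
        refine sum_le_sum fun x hx => ?_
        rw [mem_filter, Set.mem_ofPred_eq] at hx
        rw [prod_pow_eq_pow_sum, ← cardFactors_prod_eq_sum hx.1, ← Real.rpow_natCast,
          ← Real.rpow_add hz0]
        exact Real.one_le_rpow_of_pos_of_le_one_of_nonpos hz0 hz1 (by linarith [hx.2])
    _ ≤ ∑ x ∈ S, z ^ (-B) * ∏ i, z ^ ArithmeticFunction.cardFactors (x i) :=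
        sum_le_sum_of_subset_of_nonneg (filter_subset _ _) fun x _ _ => by positivity
    _ = z ^ (-B) * (∑ n ∈ Icc 1 T, z ^ ArithmeticFunction.cardFactors n) ^ k := by
        rw [← mul_sum, hS, ← prod_univ_sum (fun _ => Icc 1 T)
          fun _ n => z ^ ArithmeticFunction.cardFactors n]
        simp
    _ ≤ z ^ (-B) * (C * T * Real.log T ^ (z - 1)) ^ k := by gcongr
    _ = _ := by
        rw [mul_pow, mul_pow, ← Real.rpow_mul_natCast hL.le, Real.rpow_def_of_pos hz0,
          Real.rpow_def_of_pos hL, Real.rpow_def_of_pos hL,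
          show Real.log (Real.log T) * (k * (z - z * Real.log z - 1)) =
            Real.log z * -B + Real.log (Real.log T) * ((z - 1) * k) by rw [hB]; ring,
          Real.exp_add]
        ring

/-! ### The threshold `beta k` -/

/-- With `α = k a`, the exponent `k (a - a log a)` of both bounds is `α (1 - log α + log k)`, the
function defining `beta k`. -/
theorem mul_sub_mul_log_eq {k : ℕ} {a : ℝ} (hk : 1 ≤ k) (ha : 0 < a) :
    (k : ℝ) * (a - a * Real.log a) = k * a * (1 - Real.log (k * a) + Real.log k) := by
  have hk0 : (k : ℝ) ≠ 0 := by exact_mod_cast (by omega : k ≠ 0)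
  rw [Real.log_mul hk0 ha.ne']
  ring

theorem exists_eventually_rpow_le_uniformDraw_beta {k : ℕ} (hk : 1 ≤ k) {ε : ℝ} (hε : 0 < ε) :
    ∃ δ : ℝ, 0 < δ ∧ ∀ᶠ T : ℕ in atTop, Real.log T ^ (-(1 - δ)) ≤
      (uniformDraw k T).real {x : Fin k → ℕ |
        (ArithmeticFunction.cardFactors (∏ i, x i) : ℝ) ≤
          (beta k + ε) * Real.log (Real.log T)} := by
  have hk0 : (0 : ℝ) < k := by exact_mod_cast hk
  obtain ⟨⟨hβ0, hβ1⟩, hβ⟩ := beta_spec k hk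
  -- a point `k a` strictly between `beta k` and `min (beta k + ε) k`
  obtain ⟨a, ha0, ha1, hβa, haε⟩ : ∃ a : ℝ, 0 < a ∧ a < 1 ∧ beta k < k * a ∧
      k * a ≤ beta k + ε := by
    refine ⟨(beta k + min ε (1 / 2)) / k, ?_, ?_, ?_, ?_⟩
    · have : 0 < min ε (1 / 2) := by positivity
      positivity
    · rw [div_lt_one hk0]
      linarith [min_le_right ε (1 / 2)]
    · rw [mul_div_cancel₀ _ hk0.ne']
      have : 0 < min ε (1 / 2) := by positivity
      linarith
    · rw [mul_div_cancel₀ _ hk0.ne']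
      linarith [min_le_left ε (1 / 2)]
  have hF : (k : ℝ) - 1 < k * (a - a * Real.log a) := by
    rw [mul_sub_mul_log_eq hk ha0, ← hβ]
    exact strictMonoOn_betaFun k hk ⟨hβ0, by linarith⟩
      ⟨by positivity, mul_le_of_le_one_right hk0.le ha1.le⟩ hβa
  obtain ⟨E, hE1, hE2⟩ := exists_between ((div_lt_iff₀' hk0).2 hF)
  rw [div_lt_iff₀' hk0] at hE1
  refine ⟨k * E - (k - 1), by linarith, ?_⟩
  filter_upwards [eventually_rpow_le_uniformDraw (k := k) ha0 ha1
    (show E < a * (1 - Real.log a) by linarith), eventually_ge_atTop 3] with T hT hT3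
  have hlog : 1 ≤ Real.log T := by
    rw [Real.le_log_iff_exp_le (by positivity)]
    have : (3 : ℝ) ≤ T := by exact_mod_cast hT3
    linarith [Real.exp_one_lt_d9]
  have := isProbabilityMeasure_uniformDraw k T (by omega)
  rw [show -(1 - ((k : ℝ) * E - (k - 1))) = k * (E - 1) by ring]
  refine hT.trans (MeasureTheory.measureReal_mono fun x hx => ?_)
  exact le_trans hx (mul_le_mul_of_nonneg_right haε (Real.log_nonneg hlog))

theorem exists_eventually_uniformDraw_beta_le {k : ℕ} (hk : 2 ≤ k) {ε : ℝ} (hε : 0 < ε) :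
    ∃ δ : ℝ, 0 < δ ∧ ∃ C : ℝ, 0 < C ∧ ∀ᶠ T : ℕ in atTop,
      (uniformDraw k T).real {x : Fin k → ℕ |
        (ArithmeticFunction.cardFactors (∏ i, x i) : ℝ) ≤
          (beta k - ε) * Real.log (Real.log T)} ≤ C * Real.log T ^ (-(1 + δ)) := by
  have hk1 : 1 ≤ k := by omega
  have hk2 : (2 : ℝ) ≤ k := by exact_mod_cast hk
  have hk0 : (0 : ℝ) < k := by linarith
  obtain ⟨⟨hβ0, hβ1⟩, hβ⟩ := beta_spec k hk1
  have hβpos : 0 < beta k := by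
    refine hβ0.lt_of_ne fun h => ?_
    rw [← h] at hβ
    linarith
  -- `beta k - ε` may be negative, so a positive `k z` in `[beta k - ε, beta k)` replaces it
  obtain ⟨z, hz0, hzβ, hzε⟩ : ∃ z : ℝ, 0 < z ∧ k * z < beta k ∧ beta k - ε ≤ k * z := by
    refine ⟨max (beta k - ε) (beta k / 2) / k, ?_, ?_, ?_⟩
    · have : 0 < max (beta k - ε) (beta k / 2) := lt_max_of_lt_right (by linarith)
      positivity
    · rw [mul_div_cancel₀ _ hk0.ne']
      exact max_lt (by linarith) (by linarith)
    · rw [mul_div_cancel₀ _ hk0.ne']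
      exact le_max_left _ _
  have hz1 : z ≤ 1 := by nlinarith
  have hF : k * (z - z * Real.log z) < (k : ℝ) - 1 := by
    rw [mul_sub_mul_log_eq hk1 hz0, ← hβ]
    exact strictMonoOn_betaFun k hk1 ⟨by positivity, by linarith⟩ ⟨hβ0, by linarith⟩ hzβ
  obtain ⟨C, hC0, hC⟩ := exists_eventually_uniformDraw_le (k := k) hz0 hz1
  refine ⟨k - 1 - k * (z - z * Real.log z), by linarith, C, hC0, ?_⟩
  filter_upwards [hC, eventually_ge_atTop 3] with T hT hT3
  have hlog : 1 ≤ Real.log T := by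
    rw [Real.le_log_iff_exp_le (by positivity)]
    have : (3 : ℝ) ≤ T := by exact_mod_cast hT3
    linarith [Real.exp_one_lt_d9]
  have := isProbabilityMeasure_uniformDraw k T (by omega)
  rw [show -(1 + ((k : ℝ) - 1 - k * (z - z * Real.log z))) = k * (z - z * Real.log z - 1) by ring]
  refine le_trans (MeasureTheory.measureReal_mono fun x hx => ?_) hT
  exact le_trans hx (mul_le_mul_of_nonneg_right hzε (Real.log_nonneg hlog))

theorem mainTheorem2 (k : ℕ) (hk : 1 ≤ k) (ε : ℝ) (hε : 0 < ε) :
    ∃ δ : ℝ, 0 < δ ∧ ∃ c : ℝ, 0 < c ∧ ∃ C : ℝ, 0 < C ∧ ∃ T₀ : ℝ,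
      ∀ T : ℕ, 2 ≤ T → T₀ < (T : ℝ) →
        c * (1 / Real.log T ^ (1 - δ)) ≤
            (uniformDraw k T).real {x : Fin k → ℕ |
              (ArithmeticFunction.cardFactors (∏ i, x i) : ℝ) ≤
                (beta k + ε) * Real.log (Real.log T)} ∧
          (2 ≤ k →
            (uniformDraw k T).real {x : Fin k → ℕ |
              (ArithmeticFunction.cardFactors (∏ i, x i) : ℝ) ≤
                (beta k - ε) * Real.log (Real.log T)} ≤
              C * (1 / Real.log T ^ (1 + δ))) := by
  obtain ⟨δ₁, hδ₁, h₁⟩ := exists_eventually_rpow_le_uniformDraw_beta hk hε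
  obtain ⟨δ₂, hδ₂, C, hC, h₂⟩ : ∃ δ : ℝ, 0 < δ ∧ ∃ C : ℝ, 0 < C ∧ ∀ᶠ T : ℕ in atTop,
      2 ≤ k → (uniformDraw k T).real {x : Fin k → ℕ |
        (ArithmeticFunction.cardFactors (∏ i, x i) : ℝ) ≤
          (beta k - ε) * Real.log (Real.log T)} ≤ C * Real.log T ^ (-(1 + δ)) := by
    by_cases h : 2 ≤ k
    · obtain ⟨δ, hδ, C, hC, h'⟩ := exists_eventually_uniformDraw_beta_le h hε
      exact ⟨δ, hδ, C, hC, h'.mono fun T hT _ => hT⟩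
    · exact ⟨1, one_pos, 1, one_pos, Eventually.of_forall fun T h' => absurd h' h⟩
  obtain ⟨N, hN⟩ := eventually_atTop.1 (h₁.and h₂)
  refine ⟨min δ₁ δ₂, lt_min hδ₁ hδ₂, 1, one_pos, C, hC, max N 3, fun T _ hT => ?_⟩
  have hNT : N ≤ T := by exact_mod_cast ((le_max_left _ _).trans_lt hT).le
  have hT3 : (3 : ℝ) < T := (le_max_right _ _).trans_lt hT
  have hlog : 1 ≤ Real.log T := by
    rw [Real.le_log_iff_exp_le (by linarith)]
    linarith [Real.exp_one_lt_d9]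
  have hlog0 : 0 ≤ Real.log T := by linarith
  obtain ⟨hl, hu⟩ := hN T hNT
  rw [one_mul, one_div, one_div, ← Real.rpow_neg hlog0, ← Real.rpow_neg hlog0]
  refine ⟨le_trans ?_ hl, fun hk2 => (hu hk2).trans ?_⟩
  · exact Real.rpow_le_rpow_of_exponent_le hlog (by linarith [min_le_left δ₁ δ₂])
  · exact mul_le_mul_of_nonneg_left
      (Real.rpow_le_rpow_of_exponent_le hlog (by linarith [min_le_right δ₁ δ₂])) hC.le
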